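/- Let $d_A,d_B\ge 1$, $d=\min\{d_A,d_B\}$, and let $|\psi\rangle\in\mathbb C^{d_A}\otimes\mathbb C^{d_B}$ be a unit vector, with $\psi=|\psi\rangle\langle\psi|$. Let $|\xi_\psi\rangle=(\alpha_1,\dots,\alpha_d)$, $\alpha_i\ge 0$, be the vector of its Schmidt coefficients, i.e. $|\psi\rangle=\sum_{i=1}^d\alpha_i\,|e_i\rangle\otimes|f_i\rangle$ for some orthonormal systems $(e_i)$ in $\mathbb C^{d_A}$ and $(f_i)$ in $\mathbb C^{d_B}$ (such a decomposition exists). Notation. On Hermitian matrices put $\langle X,Y\rangle=\operatorname{Tr}(X^\dagger Y)$, and let $\preceq$ be the positive semidefinite order. Let $\mathsf{SEP}$ be the convex hull of the projectors onto normalised product vectors $|\phi\rangle\otimes|\eta\rangle$, and let $\mathsf{SEP}^*$ be its dual cone $\{X=X^\dagger:\langle X,\sigma\rangle\ge 0\ \forall \sigma\in\mathsf{SEP}\}$. For real $t\ge 0$ set $$T^{(t)}_{\mathsf{SEP}}(\rho)=\max\{\langle\rho,W\rangle : -\mathbb 1\preceq W\preceq t\,\mathbb 1,\ -W\in\mathsf{SEP}^*\}.$$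 For an integer $m\ge 1$ let $|\Psi_m\rangle=\frac{1}{\sqrt m}\sum_{i=1}^m|ii\rangle\in\mathbb C^m\otimes\mathbb C^m$, $\Psi_m=|\Psi_m\rangle\langle\Psi_m|$, and $$F_{\mathrm{SEPP}}(\rho,m)=\sup_\Lambda\,\langle\Lambda(\rho),\Psi_m\rangle,$$ where $\Lambda$ runs over the completely positive trace-preserving maps from operators on $\mathbb C^{d_A}\otimes\mathbb C^{d_B}$ to operators on $\mathbb C^m\otimes\mathbb C^m$ that map every separable state to a separable state. For real $m\ge 1$ and $x\in\mathbb C^d$ let $$\|x\|_{[m]}=\min_{x=y+z}\ \|y\|_{\ell_1}+\sqrt m\,\|z\|_{\ell_2}.$$ Theorem. For every real $m\ge 1$, $$T^{(m-1)}_{\mathsf{SEP}}(\psi)=\big\||\xi_\psi\rangle\big\|_{[m]}^2-1,$$ and for every integer $m\ge 1$, $$F_{\mathrm{SEPP}}(\psi,m)=\frac1m\,\big\||\xi_\psi\rangle\big\|_{[m]}^2 .$$ -/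

import Mathlib

noncomputable section

namespace Distill

open scoped ComplexOrder

variable {n k a b a' b' ι : Type*} [Fintype n] [DecidableEq n] [Fintype k] [DecidableEq k]
  [Fintype a] [DecidableEq a] [Fintype b] [DecidableEq b]
  [Fintype a'] [DecidableEq a'] [Fintype b'] [DecidableEq b'] [Fintype ι]

/-- Hilbert–Schmidt inner product `Tr (X† Y)`; it is a real number when `X` and `Y` are
Hermitian, the only case in which it is used. -/
def hsInner (X Y : Matrix n n ℂ) : ℝ := (X.conjTranspose * Y).trace.re

/-- The rank-one operator `|x⟩⟨x|`. -/
def ketbra (x : EuclideanSpace ℂ n) : Matrix n n ℂ := Matrix.of fun i j => x i * star (x j)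

/-- The product vector `|φ⟩ ⊗ |η⟩`, with `ℂ^a ⊗ ℂ^b` realised as `ℂ^(a × b)`. -/
def prodVec (φ : EuclideanSpace ℂ a) (η : EuclideanSpace ℂ b) : EuclideanSpace ℂ (a × b) :=
  WithLp.toLp 2 fun p => φ p.1 * η p.2

/-- Separable states: the convex hull of the projectors onto normalised product vectors. -/
def SEP (a b : Type*) [Fintype a] [Fintype b] : Set (Matrix (a × b) (a × b) ℂ) :=
  convexHull ℝ {X | ∃ (φ : EuclideanSpace ℂ a) (η : EuclideanSpace ℂ b),
    ‖φ‖ = 1 ∧ ‖η‖ = 1 ∧ X = ketbra (prodVec φ η)}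

/-- The dual cone of a set, inside the real space of Hermitian matrices. -/
def dualCone (S : Set (Matrix n n ℂ)) : Set (Matrix n n ℂ) :=
  {X | X.IsHermitian ∧ ∀ Q ∈ S, 0 ≤ hsInner X Q}

/-- The values `⟨ρ, W⟩` over the feasible `W`: `-1 ≼ W ≼ t 1` and `W ∈ -S*`. -/
def monotoneValues (S : Set (Matrix n n ℂ)) (t : ℝ) (ρ : Matrix n n ℂ) : Set ℝ :=
  {r | ∃ W : Matrix n n ℂ, (W + 1).PosSemidef ∧ (t • (1 : Matrix n n ℂ) - W).PosSemidef ∧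
    -W ∈ dualCone S ∧ r = hsInner ρ W}

/-- The monotone `T^{(t)}_S(ρ)`. -/
def monotone (S : Set (Matrix n n ℂ)) (t : ℝ) (ρ : Matrix n n ℂ) : ℝ :=
  sSup (monotoneValues S t ρ)

/-- The map `id_r ⊗ Λ`, acting blockwise. -/
def ampliation (r : ℕ) (Λ : Matrix n n ℂ →ₗ[ℂ] Matrix k k ℂ)
    (X : Matrix (Fin r × n) (Fin r × n) ℂ) : Matrix (Fin r × k) (Fin r × k) ℂ :=
  Matrix.of fun p q => Λ (Matrix.of fun i j => X (p.1, i) (q.1, j)) p.2 q.2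

/-- Completely positive trace-preserving maps. -/
structure IsCPTP (Λ : Matrix n n ℂ →ₗ[ℂ] Matrix k k ℂ) : Prop where
  completelyPositive : ∀ (r : ℕ) (X : Matrix (Fin r × n) (Fin r × n) ℂ),
    X.PosSemidef → (ampliation r Λ X).PosSemidef
  tracePreserving : ∀ X : Matrix n n ℂ, (Λ X).trace = X.trace

/-- Separability-preserving operations `AB → A'B'`. -/
def SEPP (a b a' b' : Type*) [Fintype a] [Fintype b] [Fintype a'] [Fintype b'] :
    Set (Matrix (a × b) (a × b) ℂ →ₗ[ℂ] Matrix (a' × b') (a' × b') ℂ) :=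
  {Λ | IsCPTP Λ ∧ ∀ σ ∈ SEP a b, Λ σ ∈ SEP a' b'}

/-- The maximally entangled vector `∑ i, |ii⟩ / √m`. -/
def maxEntangled (m : ℕ) : EuclideanSpace ℂ (Fin m × Fin m) :=
  WithLp.toLp 2 fun p => if p.1 = p.2 then ((1 / Real.sqrt m : ℝ) : ℂ) else 0

/-- The overlaps `⟨Λ(ρ), Ψ_m⟩` over the operations `Λ` of a class `O`. -/
def fidelityValues {m : ℕ}
    (O : Set (Matrix (a × b) (a × b) ℂ →ₗ[ℂ] Matrix (Fin m × Fin m) (Fin m × Fin m) ℂ))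
    (ρ : Matrix (a × b) (a × b) ℂ) : Set ℝ :=
  {r | ∃ Λ ∈ O, r = hsInner (Λ ρ) (ketbra (maxEntangled m))}

/-- The fidelity of distillation `F_SEPP(ρ, m)`. -/
def fidelitySEPP (ρ : Matrix (a × b) (a × b) ℂ) (m : ℕ) : ℝ :=
  sSup (fidelityValues (SEPP a b (Fin m) (Fin m)) ρ)

/-- The `m`-distillation norm: the least value of `‖y‖₁ + √m ‖z‖₂` over `x = y + z`.
The set is nonempty, bounded below by `0`, and by compactness its infimum is a minimum. -/
def distNorm (m : ℝ) (x : EuclideanSpace ℂ ι) : ℝ :=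
  sInf {r | ∃ y z : EuclideanSpace ℂ ι, x = y + z ∧ r = ∑ i, ‖y i‖ + Real.sqrt m * ‖z‖}

/-- `ξ` is a vector of Schmidt coefficients of `ψ`: `ψ = ∑ i, ξ i |e i⟩ ⊗ |f i⟩` with `ξ i ≥ 0`
and orthonormal systems `e`, `f` of length `d = min d_A d_B`. -/
def IsSchmidtVector {dA dB : ℕ} (ψ : EuclideanSpace ℂ (Fin dA × Fin dB))
    (ξ : Fin (min dA dB) → ℝ) : Prop :=
  (∀ i, 0 ≤ ξ i) ∧
  ∃ (e : Fin (min dA dB) → EuclideanSpace ℂ (Fin dA))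
    (f : Fin (min dA dB) → EuclideanSpace ℂ (Fin dB)),
    Orthonormal ℂ e ∧ Orthonormal ℂ f ∧ ψ = ∑ i, (ξ i : ℂ) • prodVec (e i) (f i)

/-- A real vector seen as a vector of complex Euclidean space. -/
def toComplexVec (ξ : ι → ℝ) : EuclideanSpace ℂ ι := WithLp.toLp 2 fun i => (ξ i : ℂ)

end Distill

end

/-!
Both quantities solve one optimisation problem: maximise `⟨ψ, X⟩` over the operators `0 ≼ X ≼ m`
with `⟨X, σ⟩ ≤ 1` for every separable `σ`. For the monotone, `W = X - 1`. For the fidelity, an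
operation `Λ` gives `X = m • Λ†(Ψ_m)`, because `⟨Ψ_m, σ⟩ ≤ 1 / m` on separable states; conversely
one measures the effect `X / m` and prepares `Ψ_m` if it occurs and a separable `τ` otherwise. The
outputs on separable states are separable as soon as `Ψ_m / m + (1 - 1 / m) τ` is, and such a `τ` is
found by averaging product states with conjugate random phases.

Upper bound: `v ↦ √⟨v, X v⟩` is a seminorm which is at most `1` on normalised product vectors and
at most `√m ‖v‖`, so along the Schmidt bases it is at most the distillation norm. Attainment: if `w`
is a dual vector with `‖w‖_∞ ≤ 1` and `‖w‖₂² ≤ m` that norms `ξ`, then `|v⟩⟨v|` is feasible for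
`v = ∑ i, w i |e i⟩ ⊗ |f i⟩`.
-/

noncomputable section

namespace Distill

open scoped ComplexOrder InnerProductSpace Kronecker
open Matrix

section HilbertSchmidt

variable {n : Type*}

lemma ketbra_eq_vecMulVec (x : EuclideanSpace ℂ n) :
    ketbra x = vecMulVec x.ofLp (star x.ofLp) := by
  ext i j
  simp [ketbra, vecMulVec_apply]

lemma posSemidef_ketbra [Finite n] (x : EuclideanSpace ℂ n) : (ketbra x).PosSemidef := by
  rw [ketbra_eq_vecMulVec]
  exact posSemidef_vecMulVec_self_star _

lemma isHermitian_ketbra (x : EuclideanSpace ℂ n) : (ketbra x).IsHermitian := by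
  ext i j
  simp [ketbra, mul_comm]

variable [Fintype n]

lemma hsInner_comm (X Y : Matrix n n ℂ) : hsInner X Y = hsInner Y X := by
  rw [hsInner, hsInner, ← conjTranspose_conjTranspose Y, ← conjTranspose_mul, trace_conjTranspose,
    conjTranspose_conjTranspose, Complex.star_def, Complex.conj_re]

lemma hsInner_add_right (X Y Z : Matrix n n ℂ) :
    hsInner X (Y + Z) = hsInner X Y + hsInner X Z := by
  simp [hsInner, mul_add]

lemma hsInner_sub_right (X Y Z : Matrix n n ℂ) :
    hsInner X (Y - Z) = hsInner X Y - hsInner X Z := by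
  simp [hsInner, mul_sub]

lemma hsInner_zero_right (X : Matrix n n ℂ) : hsInner X 0 = 0 := by
  simp [hsInner]

lemma hsInner_smul_right (c : ℝ) (X Y : Matrix n n ℂ) :
    hsInner X (c • Y) = c * hsInner X Y := by
  simp [hsInner]

lemma trace_mul_eq_hsInner {X Y : Matrix n n ℂ} (hX : X.IsHermitian) (hY : Y.IsHermitian) :
    (X * Y).trace = (hsInner X Y : ℂ) := by
  have hreal : (starRingEnd ℂ) (X * Y).trace = (X * Y).trace := by
    rw [starRingEnd_apply, ← trace_conjTranspose, conjTranspose_mul, hX.eq, hY.eq, trace_mul_comm]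
  rw [hsInner, hX.eq, Complex.conj_eq_iff_re.1 hreal]

lemma exists_eq_conjTranspose_mul_self {X : Matrix n n ℂ} (hX : X.PosSemidef) :
    ∃ C : Matrix n n ℂ, X = Cᴴ * C := by
  classical
  open scoped MatrixOrder in
  exact CStarAlgebra.nonneg_iff_eq_star_mul_self.1 hX.nonneg

lemma trace_mul_nonneg {X Y : Matrix n n ℂ} (hX : X.PosSemidef) (hY : Y.PosSemidef) :
    0 ≤ (X * Y).trace := by
  obtain ⟨C, rfl⟩ := exists_eq_conjTranspose_mul_self hX
  rw [mul_assoc, trace_mul_comm]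
  exact (hY.mul_mul_conjTranspose_same C).trace_nonneg

lemma hsInner_nonneg {X Y : Matrix n n ℂ} (hX : X.PosSemidef) (hY : Y.PosSemidef) :
    0 ≤ hsInner X Y := by
  rw [hsInner, hX.isHermitian.eq]
  exact (Complex.nonneg_iff.1 (trace_mul_nonneg hX hY)).1

lemma trace_mul_ketbra (X : Matrix n n ℂ) (x : EuclideanSpace ℂ n) :
    (X * ketbra x).trace = star x.ofLp ⬝ᵥ X *ᵥ x.ofLp := by
  rw [ketbra_eq_vecMulVec, mul_vecMulVec, trace_vecMulVec, dotProduct_comm]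

lemma trace_ketbra (x : EuclideanSpace ℂ n) : (ketbra x).trace = ((‖x‖ ^ 2 : ℝ) : ℂ) := by
  rw [ketbra_eq_vecMulVec, trace_vecMulVec, ← EuclideanSpace.inner_eq_star_dotProduct,
    inner_self_eq_norm_sq_to_K]
  norm_cast

lemma hsInner_ketbra_left (x : EuclideanSpace ℂ n) (Y : Matrix n n ℂ) :
    hsInner (ketbra x) Y = (star x.ofLp ⬝ᵥ Y *ᵥ x.ofLp).re := by
  rw [hsInner, (isHermitian_ketbra x).eq, trace_mul_comm, trace_mul_ketbra]

lemma hsInner_ketbra_one [DecidableEq n] (x : EuclideanSpace ℂ n) :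
    hsInner (ketbra x) 1 = ‖x‖ ^ 2 := by
  rw [hsInner, mul_one, (isHermitian_ketbra x).eq, trace_ketbra, Complex.ofReal_re]

lemma hsInner_ketbra_ketbra (x y : EuclideanSpace ℂ n) :
    hsInner (ketbra x) (ketbra y) = ‖⟪y, x⟫_ℂ‖ ^ 2 := by
  rw [hsInner_ketbra_left, ketbra_eq_vecMulVec, vecMulVec_mulVec, op_smul_eq_smul,
    dotProduct_smul, smul_eq_mul, dotProduct_comm (star y.ofLp), dotProduct_comm (star x.ofLp),
    ← EuclideanSpace.inner_eq_star_dotProduct, ← EuclideanSpace.inner_eq_star_dotProduct,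
    ← inner_conj_symm x y, Complex.mul_conj, Complex.ofReal_re, Complex.normSq_eq_norm_sq]

lemma posSemidef_iff_forall_trace_mul_ketbra {X : Matrix n n ℂ} :
    X.PosSemidef ↔ ∀ x, 0 ≤ (X * ketbra x).trace := by
  classical
  refine ⟨fun hX x => trace_mul_ketbra X x ▸ hX.dotProduct_mulVec_nonneg _, fun h => ?_⟩
  rw [← isPositive_toEuclideanLin_iff, LinearMap.isPositive_iff_complex]
  intro x
  have hinner : ⟪toEuclideanLin X x, x⟫_ℂ = (X * ketbra x).trace := by
    have hconj := congrArg (starRingEnd ℂ) (trace_mul_ketbra X x)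
    rw [Complex.conj_eq_iff_im.2 (Complex.nonneg_iff.1 (h x)).2.symm] at hconj
    rw [hconj, EuclideanSpace.inner_eq_star_dotProduct, starRingEnd_apply, dotProduct_comm,
      star_dotProduct]
    rfl
  rw [hinner]
  obtain ⟨hre, him⟩ := Complex.nonneg_iff.1 (h x)
  exact ⟨Complex.ext rfl him, hre⟩

lemma posSemidef_iff_forall_hsInner_ketbra {X : Matrix n n ℂ} (hX : X.IsHermitian) :
    X.PosSemidef ↔ ∀ x, 0 ≤ hsInner X (ketbra x) := by
  simp_rw [posSemidef_iff_forall_trace_mul_ketbra, trace_mul_eq_hsInner hX (isHermitian_ketbra _),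
    Complex.zero_le_real]

lemma posSemidef_smul_one_sub_ketbra [DecidableEq n] {v : EuclideanSpace ℂ n} {m : ℝ}
    (hv : ‖v‖ ^ 2 ≤ m) : (m • (1 : Matrix n n ℂ) - ketbra v).PosSemidef := by
  have hherm : (m • (1 : Matrix n n ℂ) - ketbra v).IsHermitian :=
    .sub (by simp [IsHermitian, conjTranspose_smul]) (isHermitian_ketbra v)
  refine (posSemidef_iff_forall_hsInner_ketbra hherm).2 fun x => ?_
  rw [hsInner_comm, hsInner_sub_right, hsInner_smul_right, hsInner_ketbra_one,
    hsInner_ketbra_ketbra, sub_nonneg]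
  calc ‖⟪v, x⟫_ℂ‖ ^ 2 ≤ (‖v‖ * ‖x‖) ^ 2 := by gcongr; exact norm_inner_le_norm v x
    _ = ‖v‖ ^ 2 * ‖x‖ ^ 2 := mul_pow _ _ _
    _ ≤ m * ‖x‖ ^ 2 := by gcongr

lemma exists_hsInner_ketbra_eq_norm_sq {Y : Matrix n n ℂ} (hY : Y.PosSemidef) :
    ∃ C : EuclideanSpace ℂ n →ₗ[ℂ] EuclideanSpace ℂ n,
      ∀ x, hsInner (ketbra x) Y = ‖C x‖ ^ 2 := by
  classical
  obtain ⟨C, rfl⟩ := exists_eq_conjTranspose_mul_self hY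
  refine ⟨toEuclideanLin C, fun x => ?_⟩
  have hnorm := inner_self_eq_norm_sq_to_K (𝕜 := ℂ) (toEuclideanLin C x)
  rw [EuclideanSpace.inner_eq_star_dotProduct, ofLp_toLpLin, toLin'_apply] at hnorm
  rw [hsInner_ketbra_left, ← mulVec_mulVec, dotProduct_mulVec, ← star_mulVec, dotProduct_comm,
    hnorm]
  norm_cast

end HilbertSchmidt

section SchmidtMap

variable {a b ι : Type*} [Fintype ι]

/-- The linear map sending a coefficient vector `x` to the vector `∑ i, x i |e i⟩ ⊗ |f i⟩`; for
orthonormal `e` and `f` it is an isometry, whose values on nonnegative vectors are the Schmidt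
decompositions along `e` and `f`. -/
def schmidtMap (e : ι → EuclideanSpace ℂ a) (f : ι → EuclideanSpace ℂ b) :
    EuclideanSpace ℂ ι →ₗ[ℂ] EuclideanSpace ℂ (a × b) :=
  Fintype.linearCombination ℂ (fun i => prodVec (e i) (f i)) ∘ₗ
    (WithLp.linearEquiv 2 ℂ (ι → ℂ)).toLinearMap

variable {e : ι → EuclideanSpace ℂ a} {f : ι → EuclideanSpace ℂ b}

lemma schmidtMap_apply (x : EuclideanSpace ℂ ι) :
    schmidtMap e f x = ∑ i, x i • prodVec (e i) (f i) := rfl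

lemma schmidtMap_single_one [DecidableEq ι] (i : ι) :
    schmidtMap e f (EuclideanSpace.single i 1) = prodVec (e i) (f i) := by
  simp [schmidtMap_apply, ite_smul]

end SchmidtMap

section ProductVectors

variable {a b ι : Type*} [Fintype a] [Fintype b]

lemma inner_prodVec (φ φ' : EuclideanSpace ℂ a) (η η' : EuclideanSpace ℂ b) :
    ⟪prodVec φ η, prodVec φ' η'⟫_ℂ = ⟪φ, φ'⟫_ℂ * ⟪η, η'⟫_ℂ := by
  simp only [PiLp.inner_apply, prodVec, Fintype.sum_prod_type, Finset.sum_mul_sum,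
    RCLike.inner_apply, map_mul]
  exact Finset.sum_congr rfl fun i _ => Finset.sum_congr rfl fun j _ => by ring

lemma norm_prodVec (φ : EuclideanSpace ℂ a) (η : EuclideanSpace ℂ b) :
    ‖prodVec φ η‖ = ‖φ‖ * ‖η‖ := by
  have h := inner_prodVec φ φ η η
  simp only [inner_self_eq_norm_sq_to_K] at h
  rw [← sq_eq_sq₀ (norm_nonneg _) (by positivity), mul_pow]
  exact_mod_cast h

lemma orthonormal_prodVec {e : ι → EuclideanSpace ℂ a} {f : ι → EuclideanSpace ℂ b}
    (he : Orthonormal ℂ e) (hf : Orthonormal ℂ f) :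
    Orthonormal ℂ fun i => prodVec (e i) (f i) :=
  ⟨fun i => by rw [norm_prodVec, he.1 i, hf.1 i, one_mul],
    fun _ _ hij => (inner_prodVec _ _ _ _).trans (by rw [he.2 hij, zero_mul])⟩

variable [Fintype ι] {e : ι → EuclideanSpace ℂ a} {f : ι → EuclideanSpace ℂ b}

lemma inner_schmidtMap (he : Orthonormal ℂ e) (hf : Orthonormal ℂ f) (x y : EuclideanSpace ℂ ι) :
    ⟪schmidtMap e f x, schmidtMap e f y⟫_ℂ = ⟪x, y⟫_ℂ := by
  rw [schmidtMap_apply, schmidtMap_apply, (orthonormal_prodVec he hf).inner_sum, PiLp.inner_apply]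
  exact Finset.sum_congr rfl fun i _ => mul_comm _ _

lemma norm_schmidtMap (he : Orthonormal ℂ e) (hf : Orthonormal ℂ f) (x : EuclideanSpace ℂ ι) :
    ‖schmidtMap e f x‖ = ‖x‖ := by
  rw [@norm_eq_sqrt_re_inner ℂ, @norm_eq_sqrt_re_inner ℂ, inner_schmidtMap he hf]

lemma norm_inner_schmidtMap_prodVec_le (he : Orthonormal ℂ e) (hf : Orthonormal ℂ f)
    {w : EuclideanSpace ℂ ι} {c : ℝ} (hc : 0 ≤ c) (hw : ∀ i, ‖w i‖ ≤ c)
    (φ : EuclideanSpace ℂ a) (η : EuclideanSpace ℂ b) :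
    ‖⟪schmidtMap e f w, prodVec φ η⟫_ℂ‖ ≤ c * (‖φ‖ * ‖η‖) := by
  have bessel_sqrt_e : √(∑ i, ‖⟪e i, φ⟫_ℂ‖ ^ 2) ≤ ‖φ‖ :=
    Real.sqrt_le_left (norm_nonneg φ) |>.2 (he.sum_inner_products_le φ)
  have bessel_sqrt_f : √(∑ i, ‖⟪f i, η⟫_ℂ‖ ^ 2) ≤ ‖η‖ :=
    Real.sqrt_le_left (norm_nonneg η) |>.2 (hf.sum_inner_products_le η)
  calc ‖⟪schmidtMap e f w, prodVec φ η⟫_ℂ‖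
      ≤ ∑ i, ‖w i‖ * (‖⟪e i, φ⟫_ℂ‖ * ‖⟪f i, η⟫_ℂ‖) := by
        rw [schmidtMap_apply, sum_inner]
        refine (norm_sum_le _ _).trans_eq (Finset.sum_congr rfl fun i _ => ?_)
        rw [inner_smul_left, inner_prodVec, norm_mul, norm_mul, RCLike.norm_conj]
    _ ≤ ∑ i, c * (‖⟪e i, φ⟫_ℂ‖ * ‖⟪f i, η⟫_ℂ‖) := by gcongr with i; exact hw i
    _ ≤ c * (√(∑ i, ‖⟪e i, φ⟫_ℂ‖ ^ 2) * √(∑ i, ‖⟪f i, η⟫_ℂ‖ ^ 2)) := by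
        rw [← Finset.mul_sum]
        gcongr
        exact Real.sum_mul_le_sqrt_mul_sqrt _ _ _
    _ ≤ c * (‖φ‖ * ‖η‖) := by gcongr

end ProductVectors

section SeparableStates

variable {a b ι : Type*} [Fintype a] [Fintype b]

lemma convex_SEP : Convex ℝ (SEP a b) := convex_convexHull ℝ _

lemma ketbra_prodVec_mem_SEP {φ : EuclideanSpace ℂ a} {η : EuclideanSpace ℂ b}
    (hφ : ‖φ‖ = 1) (hη : ‖η‖ = 1) : ketbra (prodVec φ η) ∈ SEP a b :=
  subset_convexHull ℝ _ ⟨φ, η, hφ, hη, rfl⟩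

lemma SEP_subset_of_convex {S : Set (Matrix (a × b) (a × b) ℂ)} (hS : Convex ℝ S)
    (h : ∀ (φ : EuclideanSpace ℂ a) (η : EuclideanSpace ℂ b), ‖φ‖ = 1 → ‖η‖ = 1 →
      ketbra (prodVec φ η) ∈ S) : SEP a b ⊆ S := by
  refine convexHull_min ?_ hS
  rintro _ ⟨φ, η, hφ, hη, rfl⟩
  exact h φ η hφ hη

lemma posSemidef_of_mem_SEP {σ : Matrix (a × b) (a × b) ℂ} (hσ : σ ∈ SEP a b) :
    σ.PosSemidef :=
  SEP_subset_of_convex (S := {X | X.PosSemidef})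
    (fun _ hX _ hY _ _ hs ht _ => (hX.smul hs).add (hY.smul ht))
    (fun _ _ _ _ => posSemidef_ketbra _) hσ

lemma trace_of_mem_SEP {σ : Matrix (a × b) (a × b) ℂ} (hσ : σ ∈ SEP a b) : σ.trace = 1 := by
  refine SEP_subset_of_convex (S := {X | X.trace = 1}) ?_ ?_ hσ
  · exact (convex_singleton (1 : ℂ)).is_linear_preimage
      ⟨fun X Y => trace_add X Y, fun c X => trace_smul c X⟩
  · intro φ η hφ hη
    simp [trace_ketbra, norm_prodVec, hφ, hη]

lemma hsInner_ketbra_schmidtMap_le_of_mem_SEP [Fintype ι] {e : ι → EuclideanSpace ℂ a}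
    {f : ι → EuclideanSpace ℂ b} (he : Orthonormal ℂ e) (hf : Orthonormal ℂ f)
    {w : EuclideanSpace ℂ ι} {c : ℝ} (hc : 0 ≤ c) (hw : ∀ i, ‖w i‖ ≤ c)
    {σ : Matrix (a × b) (a × b) ℂ} (hσ : σ ∈ SEP a b) :
    hsInner (ketbra (schmidtMap e f w)) σ ≤ c ^ 2 := by
  refine SEP_subset_of_convex (S := {X | hsInner (ketbra (schmidtMap e f w)) X ≤ c ^ 2}) ?_ ?_ hσ
  · exact convex_halfSpace_le ⟨hsInner_add_right _, fun c => hsInner_smul_right c _⟩ _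
  · intro φ η hφ hη
    have h := norm_inner_schmidtMap_prodVec_le he hf hc hw φ η
    rw [hφ, hη, mul_one, mul_one, norm_inner_symm] at h
    rw [Set.mem_ofPred_eq, hsInner_ketbra_ketbra]
    gcongr

end SeparableStates

section DistillationNorm

variable {ι : Type*} [Fintype ι]

lemma distNorm_add_le (m : ℝ) (y z : EuclideanSpace ℂ ι) :
    distNorm m (y + z) ≤ ∑ i, ‖y i‖ + √m * ‖z‖ := by
  refine csInf_le ⟨0, ?_⟩ ⟨y, z, rfl, rfl⟩
  rintro _ ⟨y, z, -, rfl⟩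
  positivity

lemma distNorm_nonneg (m : ℝ) (x : EuclideanSpace ℂ ι) : 0 ≤ distNorm m x := by
  refine Real.sInf_nonneg ?_
  rintro _ ⟨y, z, -, rfl⟩
  positivity

lemma norm_map_le_distNorm [DecidableEq ι] {F : Type*} [SeminormedAddCommGroup F]
    [NormedSpace ℂ F] {m : ℝ} {L : EuclideanSpace ℂ ι →ₗ[ℂ] F}
    (hsingle : ∀ i, ‖L (EuclideanSpace.single i 1)‖ ≤ 1) (hL : ∀ x, ‖L x‖ ≤ √m * ‖x‖)
    (x : EuclideanSpace ℂ ι) : ‖L x‖ ≤ distNorm m x := by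
  refine le_csInf ⟨_, x, 0, (add_zero x).symm, rfl⟩ ?_
  rintro _ ⟨y, z, rfl, rfl⟩
  rw [map_add]
  refine norm_add_le_of_le ?_ (hL z)
  have hy : L y = ∑ i, y i • L (EuclideanSpace.single i 1) := by
    conv_lhs => rw [← (EuclideanSpace.basisFun ι ℂ).sum_repr y, map_sum]
    simp
  rw [hy]
  refine (norm_sum_le _ _).trans (Finset.sum_le_sum fun i _ => ?_)
  rw [norm_smul]
  exact mul_le_of_le_one_right (norm_nonneg _) (hsingle i)

lemma norm_toComplexVec_sq (w : ι → ℝ) : ‖toComplexVec w‖ ^ 2 = ∑ i, w i ^ 2 := by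
  simp [EuclideanSpace.norm_sq_eq, toComplexVec]

lemma inner_toComplexVec (w x : ι → ℝ) :
    ⟪toComplexVec w, toComplexVec x⟫_ℂ = ((∑ i, w i * x i : ℝ) : ℂ) := by
  simp [PiLp.inner_apply, toComplexVec, mul_comm]

/- Complementary slackness: the dual vector `w` is extremal both for the `ℓ¹` part `y` and for the
`ℓ²` part `l • w`. -/
lemma distNorm_toComplexVec_le {m l : ℝ} {w y : ι → ℝ} (hl : 0 ≤ l)
    (hwy : ∀ i, w i * y i = |y i|) (hslack : l = 0 ∨ ∑ i, w i ^ 2 = m) :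
    distNorm m (toComplexVec (y + l • w)) ≤ ∑ i, w i * (y i + l * w i) := by
  have hsplit : toComplexVec (y + l • w) = toComplexVec y + toComplexVec (l • w) := by
    ext i
    simp [toComplexVec]
  have hnorm : √m * ‖toComplexVec (l • w)‖ = l * ∑ i, w i ^ 2 := by
    have hsq : ‖toComplexVec (l • w)‖ = l * √(∑ i, w i ^ 2) := by
      rw [← Real.sqrt_sq (norm_nonneg (toComplexVec (l • w))), norm_toComplexVec_sq]
      simp only [Pi.smul_apply, smul_eq_mul, mul_pow, ← Finset.mul_sum]
      rw [Real.sqrt_mul (sq_nonneg l), Real.sqrt_sq hl]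
    rcases hslack with rfl | rfl
    · rw [hsq, zero_mul, zero_mul, mul_zero]
    · rw [hsq, mul_left_comm, Real.mul_self_sqrt (by positivity)]
  calc distNorm m (toComplexVec (y + l • w))
      ≤ ∑ i, ‖toComplexVec y i‖ + √m * ‖toComplexVec (l • w)‖ := hsplit ▸ distNorm_add_le m _ _
    _ = ∑ i, w i * y i + l * ∑ i, w i ^ 2 := by
        rw [hnorm]
        simp only [hwy, toComplexVec, Complex.norm_real, Real.norm_eq_abs]
    _ = ∑ i, w i * (y i + l * w i) := by
        rw [Finset.mul_sum, ← Finset.sum_add_distrib]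
        exact Finset.sum_congr rfl fun i _ => by ring

open Finset in
lemma exists_sum_min_sq_eq {ξ : ι → ℝ} (hξ : ∀ i, 0 ≤ ξ i) {m : ℝ} (hm : 0 < m)
    (hcard : m ≤ #{i | ξ i ≠ 0}) : ∃ l, 0 < l ∧ ∑ i, min (ξ i) l ^ 2 = m * l ^ 2 := by
  obtain ⟨k, hk, hmin⟩ : ∃ k ∈ {i | ξ i ≠ 0}, ∀ i ∈ ({i | ξ i ≠ 0} : Finset ι), ξ k ≤ ξ i := by
    have hne : ({i | ξ i ≠ 0} : Finset ι).Nonempty := by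
      rw [← card_pos]
      exact_mod_cast hm.trans_le hcard
    simpa using exists_min_image _ ξ hne
  have hξk : 0 < ξ k := (hξ k).lt_of_ne' hk
  have hlow : m * ξ k ^ 2 ≤ ∑ i, min (ξ i) (ξ k) ^ 2 := calc
    m * ξ k ^ 2 ≤ #{i | ξ i ≠ 0} * ξ k ^ 2 := by gcongr
    _ = ∑ i with ξ i ≠ 0, min (ξ i) (ξ k) ^ 2 := by
        rw [← nsmul_eq_mul, ← sum_const]
        exact sum_congr rfl fun i hi => by rw [min_eq_right (hmin i hi)]
    _ ≤ ∑ i, min (ξ i) (ξ k) ^ 2 :=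
        sum_le_sum_of_subset_of_nonneg (filter_subset _ _) fun i _ _ => sq_nonneg _
  set u := ξ k + √(∑ i, ξ i ^ 2 / m)
  have hku : ξ k ≤ u := le_add_of_nonneg_right (Real.sqrt_nonneg _)
  have hhigh : ∑ i, min (ξ i) u ^ 2 ≤ m * u ^ 2 := calc
    ∑ i, min (ξ i) u ^ 2 ≤ ∑ i, ξ i ^ 2 := by
        gcongr with i
        · exact le_min (hξ i) (hξk.le.trans hku)
        · exact min_le_left _ _
    _ = m * √(∑ i, ξ i ^ 2 / m) ^ 2 := by
        rw [Real.sq_sqrt (by positivity), ← sum_div]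
        field_simp
    _ ≤ m * u ^ 2 := by gcongr; exact le_add_of_nonneg_left hξk.le
  obtain ⟨l, hl, hleq⟩ := isPreconnected_Icc.intermediate_value₂ (Set.left_mem_Icc.2 hku)
    (Set.right_mem_Icc.2 hku) (f := fun l => m * l ^ 2) (g := fun l => ∑ i, min (ξ i) l ^ 2)
    (by fun_prop) (by fun_prop) hlow hhigh
  exact ⟨l, hξk.trans_le hl.1, hleq.symm⟩

/- The optimal dual vector is `min (ξ / l) 1`, where the threshold `l` is fixed by `∑ w² = m`; if
the support of `ξ` has fewer than `m` elements, its indicator is optimal. -/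
open Finset in
lemma exists_distNorm_le_sum_mul {ξ : ι → ℝ} (hξ : ∀ i, 0 ≤ ξ i) {m : ℝ} (hm : 0 < m) :
    ∃ w : ι → ℝ, (∀ i, 0 ≤ w i) ∧ (∀ i, w i ≤ 1) ∧ ∑ i, w i ^ 2 ≤ m ∧
      distNorm m (toComplexVec ξ) ≤ ∑ i, w i * ξ i := by
  rcases le_or_gt m #{i | ξ i ≠ 0} with hcard | hcard
  · obtain ⟨l, hl, hleq⟩ := exists_sum_min_sq_eq hξ hm hcard
    set w : ι → ℝ := fun i => min (ξ i) l / l with hw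
    have hlw : ∀ i, l * w i = min (ξ i) l := fun i => mul_div_cancel₀ _ hl.ne'
    have hsum : ∑ i, w i ^ 2 = m := by
      simp only [hw, div_pow, ← sum_div, hleq]
      field_simp
    refine ⟨w, fun i => div_nonneg (le_min (hξ i) hl.le) hl.le,
      fun i => (div_le_one hl).2 (min_le_right _ _), hsum.le, ?_⟩
    have hwy : ∀ i, w i * (ξ - l • w) i = |(ξ - l • w) i| := by
      intro i
      simp only [Pi.sub_apply, Pi.smul_apply, smul_eq_mul, hlw]
      rcases le_total (ξ i) l with h | h
      · simp [min_eq_left h]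
      · rw [min_eq_right h, abs_of_nonneg (sub_nonneg.2 h), hw]
        simp [min_eq_right h, hl.ne']
    simpa using distNorm_toComplexVec_le hl.le hwy (.inr hsum)
  · set w : ι → ℝ := fun i => if ξ i ≠ 0 then 1 else 0 with hw
    refine ⟨w, fun i => by simp only [hw]; positivity, fun i => ?_, ?_, ?_⟩
    · simp only [hw]; split_ifs <;> simp
    · calc ∑ i, w i ^ 2 = #{i | ξ i ≠ 0} := by simp [hw, sum_ite]
        _ ≤ m := hcard.le
    · have hwy : ∀ i, w i * ξ i = |ξ i| := fun i => by
        by_cases h : ξ i = 0 <;> simp [hw, h, abs_of_nonneg (hξ i)]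
      simpa using distNorm_toComplexVec_le le_rfl hwy (.inl rfl)

end DistillationNorm

section SeparableTests

variable {a b ι : Type*} [Fintype a] [Fintype b] [Fintype ι] [DecidableEq a] [DecidableEq b]

/-- The operators `0 ≼ X ≼ m` whose expectation in every separable state is at most `1`. The
feasible points `W` of the monotone are the `X - 1`, and those of the fidelity are, up to a factor
`m`, the pullbacks of the maximally entangled projector. -/
def sepTests (a b : Type*) [Fintype a] [Fintype b] [DecidableEq a] [DecidableEq b] (m : ℝ) :
    Set (Matrix (a × b) (a × b) ℂ) :=
  {X | X.PosSemidef ∧ (m • (1 : Matrix (a × b) (a × b) ℂ) - X).PosSemidef ∧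
    ∀ σ ∈ SEP a b, hsInner X σ ≤ 1}

variable {e : ι → EuclideanSpace ℂ a} {f : ι → EuclideanSpace ℂ b}

lemma hsInner_ketbra_schmidtMap_le_distNorm_sq (he : Orthonormal ℂ e) (hf : Orthonormal ℂ f)
    {m : ℝ} (hm : 0 ≤ m) {X : Matrix (a × b) (a × b) ℂ} (hX : X ∈ sepTests a b m)
    (x : EuclideanSpace ℂ ι) : hsInner (ketbra (schmidtMap e f x)) X ≤ distNorm m x ^ 2 := by
  classical
  obtain ⟨hX0, hXm, hXsep⟩ := hX
  obtain ⟨C, hC⟩ := exists_hsInner_ketbra_eq_norm_sq hX0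
  have hsingle : ∀ i, ‖C (schmidtMap e f (EuclideanSpace.single i 1))‖ ≤ 1 := by
    intro i
    rw [schmidtMap_single_one, ← sq_le_one_iff₀ (norm_nonneg _), ← hC, hsInner_comm]
    exact hXsep _ (ketbra_prodVec_mem_SEP (he.1 i) (hf.1 i))
  have hbound : ∀ x, ‖C (schmidtMap e f x)‖ ≤ √m * ‖x‖ := by
    intro x
    have h := hsInner_nonneg (posSemidef_ketbra (schmidtMap e f x)) hXm
    rw [hsInner_sub_right, hsInner_smul_right, hsInner_ketbra_one, hC, norm_schmidtMap he hf,
      sub_nonneg] at h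
    refine le_of_sq_le_sq ?_ (by positivity)
    rwa [mul_pow, Real.sq_sqrt hm]
  rw [hC]
  exact pow_le_pow_left₀ (norm_nonneg _)
    (norm_map_le_distNorm (L := C ∘ₗ schmidtMap e f) hsingle hbound x) 2

lemma exists_mem_sepTests_hsInner_eq (he : Orthonormal ℂ e) (hf : Orthonormal ℂ f) {ξ : ι → ℝ}
    (hξ : ∀ i, 0 ≤ ξ i) {m : ℝ} (hm : 0 < m) :
    ∃ X ∈ sepTests a b m,
      hsInner (ketbra (schmidtMap e f (toComplexVec ξ))) X
        = distNorm m (toComplexVec ξ) ^ 2 := by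
  obtain ⟨w, hw0, hw1, hwm, hw⟩ := exists_distNorm_le_sum_mul hξ hm
  have hmem : ketbra (schmidtMap e f (toComplexVec w)) ∈ sepTests a b m := by
    refine ⟨posSemidef_ketbra _, posSemidef_smul_one_sub_ketbra ?_, fun σ hσ => ?_⟩
    · rwa [norm_schmidtMap he hf, norm_toComplexVec_sq]
    · have hnorm : ∀ i, ‖toComplexVec w i‖ ≤ 1 := fun i => by
        simpa [toComplexVec, abs_of_nonneg (hw0 i)] using hw1 i
      simpa using hsInner_ketbra_schmidtMap_le_of_mem_SEP he hf zero_le_one hnorm hσ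
  refine ⟨_, hmem, (hsInner_ketbra_schmidtMap_le_distNorm_sq he hf hm.le hmem _).antisymm ?_⟩
  rw [hsInner_ketbra_ketbra, inner_schmidtMap he hf, inner_toComplexVec, Complex.norm_real,
    Real.norm_eq_abs, sq_abs]
  exact pow_le_pow_left₀ (distNorm_nonneg _ _) hw 2

end SeparableTests

section Monotone

variable {a b ι : Type*} [Fintype a] [Fintype b] [Fintype ι] [DecidableEq a] [DecidableEq b]

lemma hsInner_one_of_mem_SEP {σ : Matrix (a × b) (a × b) ℂ} (hσ : σ ∈ SEP a b) :
    hsInner 1 σ = 1 := by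
  simp [hsInner, trace_of_mem_SEP hσ]

lemma monotoneValues_eq_image_sepTests (m : ℝ) (ρ : Matrix (a × b) (a × b) ℂ) :
    monotoneValues (SEP a b) (m - 1) ρ
      = (fun X => hsInner ρ X - hsInner ρ 1) '' sepTests a b m := by
  have hdual : ∀ W σ : Matrix (a × b) (a × b) ℂ, σ ∈ SEP a b →
      hsInner (-W) σ = 1 - hsInner (W + 1) σ := fun W σ hσ => by
    rw [hsInner_comm (W + 1), hsInner_add_right, hsInner_comm σ 1, hsInner_one_of_mem_SEP hσ,
      hsInner_comm (-W), ← zero_sub, hsInner_sub_right, hsInner_zero_right]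
    ring
  have hupper : ∀ W : Matrix (a × b) (a × b) ℂ, (m - 1) • 1 - W = m • 1 - (W + 1) := fun W => by
    rw [sub_smul, one_smul]
    abel
  ext r
  constructor
  · rintro ⟨W, hW0, hWm, ⟨-, hWsep⟩, rfl⟩
    refine ⟨W + 1, ⟨hW0, hupper W ▸ hWm, fun σ hσ => ?_⟩, ?_⟩
    · have h := hWsep σ hσ
      rwa [hdual W σ hσ, sub_nonneg] at h
    · simp only [hsInner_add_right, add_sub_cancel_right]
  · rintro ⟨X, ⟨hX0, hXm, hXsep⟩, rfl⟩
    refine ⟨X - 1, by rwa [sub_add_cancel], ?_, ⟨?_, fun σ hσ => ?_⟩, ?_⟩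
    · rwa [hupper, sub_add_cancel]
    · exact (hX0.isHermitian.sub isHermitian_one).neg
    · rw [hdual _ σ hσ, sub_add_cancel, sub_nonneg]
      exact hXsep σ hσ
    · rw [hsInner_sub_right]

lemma isGreatest_monotoneValues_schmidtMap {e : ι → EuclideanSpace ℂ a}
    {f : ι → EuclideanSpace ℂ b} (he : Orthonormal ℂ e) (hf : Orthonormal ℂ f) {ξ : ι → ℝ}
    (hξ : ∀ i, 0 ≤ ξ i) {m : ℝ} (hm : 0 < m) :
    IsGreatest
      (monotoneValues (SEP a b) (m - 1) (ketbra (schmidtMap e f (toComplexVec ξ))))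
      (distNorm m (toComplexVec ξ) ^ 2 - ‖schmidtMap e f (toComplexVec ξ)‖ ^ 2) := by
  rw [monotoneValues_eq_image_sepTests, hsInner_ketbra_one]
  constructor
  · obtain ⟨X, hX, hXeq⟩ := exists_mem_sepTests_hsInner_eq he hf hξ hm
    exact ⟨X, hX, by simp only [hXeq]⟩
  · rintro _ ⟨X, hX, rfl⟩
    exact sub_le_sub_right (hsInner_ketbra_schmidtMap_le_distNorm_sq he hf hm.le hX _) _

end Monotone

section Channels

variable {n k r : Type*} [Fintype n]

lemma exists_forall_trace_mul_eq (g : Matrix n n ℂ →ₗ[ℂ] ℂ) :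
    ∃ X : Matrix n n ℂ, ∀ Y, (X * Y).trace = g Y := by
  classical
  refine ⟨Matrix.of fun i j => g (Matrix.single j i 1), fun Y => ?_⟩
  have hY : g Y = ∑ i, ∑ j, Y i j * g (Matrix.single i j 1) := by
    conv_lhs => rw [matrix_eq_sum_single Y]
    simp only [map_sum]
    refine Finset.sum_congr rfl fun i _ => Finset.sum_congr rfl fun j _ => ?_
    rw [← smul_eq_mul, ← map_smul, smul_single, smul_eq_mul, mul_one]
  rw [hY, trace_mul_comm]
  simp only [trace, diag_apply, mul_apply, of_apply]

lemma IsCPTP.posSemidef_map {Λ : Matrix n n ℂ →ₗ[ℂ] Matrix k k ℂ} [Fintype k] (hΛ : IsCPTP Λ)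
    {X : Matrix n n ℂ} (hX : X.PosSemidef) : (Λ X).PosSemidef :=
  (hΛ.completelyPositive 1 (X.submatrix Prod.snd Prod.snd) (hX.submatrix _)).submatrix
    fun i : k => ((0 : Fin 1), i)

lemma IsCPTP.exists_pullback [Fintype k] [DecidableEq n] [DecidableEq k]
    {Λ : Matrix n n ℂ →ₗ[ℂ] Matrix k k ℂ} (hΛ : IsCPTP Λ) {E : Matrix k k ℂ} (hE : E.PosSemidef)
    (hE1 : (1 - E).PosSemidef) :
    ∃ X : Matrix n n ℂ, X.PosSemidef ∧ (1 - X).PosSemidef ∧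
      ∀ Y, (X * Y).trace = (E * Λ Y).trace := by
  obtain ⟨X, hX⟩ := exists_forall_trace_mul_eq
    (traceLinearMap k ℂ ℂ ∘ₗ LinearMap.mulLeft ℂ E ∘ₗ Λ)
  replace hX : ∀ Y, (X * Y).trace = (E * Λ Y).trace := hX
  refine ⟨X, posSemidef_iff_forall_trace_mul_ketbra.2 fun x => ?_,
    posSemidef_iff_forall_trace_mul_ketbra.2 fun x => ?_, hX⟩
  · rw [hX]
    exact trace_mul_nonneg hE (hΛ.posSemidef_map (posSemidef_ketbra x))
  · have h := trace_mul_nonneg hE1 (hΛ.posSemidef_map (posSemidef_ketbra x))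
    rw [sub_mul, one_mul, trace_sub, hΛ.tracePreserving, ← hX] at h
    rwa [sub_mul, one_mul, trace_sub]

lemma posSemidef_trace_mul_block [Finite r] {A : Matrix n n ℂ} (hA : A.PosSemidef)
    {X : Matrix (r × n) (r × n) ℂ} (hX : X.PosSemidef) :
    (Matrix.of fun p q => (A * Matrix.of fun i j => X (p, i) (q, j)).trace).PosSemidef := by
  cases nonempty_fintype r
  refine posSemidef_iff_forall_trace_mul_ketbra.2 fun x => ?_
  convert trace_mul_nonneg ((posSemidef_ketbra x).kronecker hA) hX using 1
  rw [trace_mul_comm]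
  simp only [trace, diag_apply, mul_apply, of_apply, kroneckerMap_apply, Fintype.sum_prod_type,
    Finset.mul_sum, mul_assoc]
  exact Finset.sum_congr rfl fun q _ => Finset.sum_comm

/-- The channel branch that measures the effect `A` and, upon success, prepares `P`. -/
def measurePrepare (A : Matrix n n ℂ) (P : Matrix k k ℂ) : Matrix n n ℂ →ₗ[ℂ] Matrix k k ℂ :=
  (traceLinearMap n ℂ ℂ ∘ₗ LinearMap.mulLeft ℂ A).smulRight P

lemma measurePrepare_apply (A : Matrix n n ℂ) (P : Matrix k k ℂ) (Y : Matrix n n ℂ) :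
    measurePrepare A P Y = (A * Y).trace • P := rfl

lemma measurePrepare_apply_of_isHermitian {A Y : Matrix n n ℂ} (hA : A.IsHermitian)
    (hY : Y.IsHermitian) (P : Matrix k k ℂ) : measurePrepare A P Y = hsInner A Y • P := by
  rw [measurePrepare_apply, trace_mul_eq_hsInner hA hY, Complex.coe_smul]

lemma posSemidef_ampliation_measurePrepare [Finite k] {A : Matrix n n ℂ} {P : Matrix k k ℂ}
    (hA : A.PosSemidef) (hP : P.PosSemidef) (r : ℕ) {X : Matrix (Fin r × n) (Fin r × n) ℂ}
    (hX : X.PosSemidef) : (ampliation r (measurePrepare A P) X).PosSemidef :=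
  (posSemidef_trace_mul_block hA hX).kronecker hP

lemma isCPTP_measurePrepare_add [Fintype k] [DecidableEq n] {A : Matrix n n ℂ}
    {P T : Matrix k k ℂ} (hA : A.PosSemidef) (hA1 : (1 - A).PosSemidef) (hP : P.PosSemidef)
    (hT : T.PosSemidef) (hPtr : P.trace = 1) (hTtr : T.trace = 1) :
    IsCPTP (measurePrepare A P + measurePrepare (1 - A) T) where
  completelyPositive r _ hX :=
    (posSemidef_ampliation_measurePrepare hA hP r hX).add
      (posSemidef_ampliation_measurePrepare hA1 hT r hX)
  tracePreserving X := by
    rw [LinearMap.add_apply, measurePrepare_apply, measurePrepare_apply, trace_add, trace_smul,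
      trace_smul, hPtr, hTtr, ← add_smul, ← trace_add, ← add_mul, add_sub_cancel, one_mul,
      smul_eq_mul, mul_one]

variable {a b a' b' : Type*} [Fintype a] [Fintype b] [Fintype a'] [Fintype b']
  [DecidableEq a] [DecidableEq b]

lemma measurePrepare_add_mem_SEPP {A : Matrix (a × b) (a × b) ℂ}
    {P τ : Matrix (a' × b') (a' × b') ℂ} {c : ℝ} (hA : A.PosSemidef) (hA1 : (1 - A).PosSemidef)
    (hAsep : ∀ σ ∈ SEP a b, hsInner A σ ≤ c) (hP : P.PosSemidef) (hPtr : P.trace = 1)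
    (hτ : τ ∈ SEP a' b') (hc : 0 < c) (hmix : c • P + (1 - c) • τ ∈ SEP a' b') :
    measurePrepare A P + measurePrepare (1 - A) τ ∈ SEPP a b a' b' := by
  refine ⟨isCPTP_measurePrepare_add hA hA1 hP (posSemidef_of_mem_SEP hτ) hPtr
    (trace_of_mem_SEP hτ), fun σ hσ => ?_⟩
  have hσ0 := posSemidef_of_mem_SEP hσ
  set s := hsInner A σ
  have hs0 : 0 ≤ s := hsInner_nonneg hA hσ0
  have hs1 : hsInner (1 - A) σ = 1 - s := by
    rw [hsInner_comm, hsInner_sub_right, hsInner_comm σ, hsInner_comm σ,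
      hsInner_one_of_mem_SEP hσ]
  have hout : (measurePrepare A P + measurePrepare (1 - A) τ : _ →ₗ[ℂ] _) σ
      = (s / c) • (c • P + (1 - c) • τ) + (1 - s / c) • τ := by
    rw [LinearMap.add_apply, measurePrepare_apply_of_isHermitian hA.1 hσ0.1,
      measurePrepare_apply_of_isHermitian hA1.1 hσ0.1, hs1, smul_add, smul_smul, smul_smul,
      add_assoc, ← add_smul, div_mul_cancel₀ _ hc.ne']
    congr 2
    field_simp
    ring
  rw [hout]
  exact convex_SEP hmix hτ (div_nonneg hs0 hc.le)
    (sub_nonneg.2 ((div_le_one hc).2 (hAsep σ hσ))) (by ring)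

end Channels

section CharacterOrthogonality

variable {κ : Type*}

lemma forall_sub_sub_add_eq_zero_iff {R : Type*} [Ring R] (h2 : (2 : R) ≠ 0) {i j k l : κ} :
    (∀ θ : κ → R, θ i - θ j - θ k + θ l = 0) ↔ (i = j ∧ k = l) ∨ (i = k ∧ j = l) := by
  classical
  have h1 : (1 : R) ≠ 0 := fun h => h2 (by rw [← one_add_one_eq_two, h, add_zero])
  refine ⟨fun h => ?_, ?_⟩
  · by_cases hij : i = j
    · subst hij
      refine .inl ⟨rfl, by_contra fun hkl => ?_⟩
      simpa [Pi.single_apply, Ne.symm hkl, h1] using h (Pi.single k 1)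
    by_cases hik : i = k
    · subst hik
      refine .inr ⟨rfl, by_contra fun hjl => ?_⟩
      simpa [hij, Ne.symm hjl, h1] using h (Pi.single j 1)
    have hi := h (Pi.single i 1)
    by_cases hil : l = i
    · exact absurd hi (by simp [hil, Ne.symm hij, Ne.symm hik, one_add_one_eq_two, h2])
    · exact absurd hi (by simp [hil, Ne.symm hij, Ne.symm hik, h1])
  · rintro (⟨rfl, rfl⟩ | ⟨rfl, rfl⟩) θ <;> simp

variable [Fintype κ] [DecidableEq κ]

lemma sum_stdAddChar_sub_sub_add {N : ℕ} [NeZero N] (h2 : (2 : ZMod N) ≠ 0) (i j k l : κ) :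
    ∑ θ : κ → ZMod N, ZMod.stdAddChar (θ i - θ j - θ k + θ l)
      = if (i = j ∧ k = l) ∨ (i = k ∧ j = l) then (Fintype.card (κ → ZMod N) : ℂ) else 0 := by
  let exponent : (κ → ZMod N) →+ ZMod N :=
    let coord := Pi.evalAddMonoidHom fun _ : κ => ZMod N
    coord i - coord j - coord k + coord l
  let χ : AddChar (κ → ZMod N) ℂ := (ZMod.stdAddChar (N := N)).compAddMonoidHom exponent
  have hχ : ∀ θ, χ θ = ZMod.stdAddChar (θ i - θ j - θ k + θ l) := fun _ => rfl
  have htrivial : χ = 0 ↔ (i = j ∧ k = l) ∨ (i = k ∧ j = l) := by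
    rw [← forall_sub_sub_add_eq_zero_iff h2, AddChar.ext_iff]
    refine forall_congr' fun θ => ?_
    rw [hχ, AddChar.zero_apply, ← AddChar.map_zero_eq_one (ZMod.stdAddChar (N := N)),
      ZMod.injective_stdAddChar.eq_iff]
  classical
  simp only [← hχ, AddChar.sum_eq_ite, htrivial]

end CharacterOrthogonality

section SeparabilityThreshold

lemma inv_card_smul_sum_mem {E α : Type*} [AddCommGroup E] [Module ℝ E] {S : Set E}
    (hS : Convex ℝ S) {t : Finset α} (ht : t.Nonempty) {z : α → E} (hz : ∀ i ∈ t, z i ∈ S) :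
    (t.card : ℝ)⁻¹ • ∑ i ∈ t, z i ∈ S := by
  rw [Finset.smul_sum]
  refine hS.sum_mem (fun _ _ => by positivity) ?_ hz
  rw [Finset.sum_const, nsmul_eq_mul, mul_inv_cancel₀]
  exact_mod_cast ht.card_pos.ne'

/-- The projector onto the span of the product basis vectors `|ij⟩` with `i ≠ j`. -/
def offDiagProj (κ : Type*) [DecidableEq κ] : Matrix (κ × κ) (κ × κ) ℂ :=
  Matrix.diagonal fun p => if p.1 = p.2 then 0 else 1

lemma offDiagProj_eq_sum_ketbra {κ : Type*} [Fintype κ] [DecidableEq κ] :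
    offDiagProj κ = ∑ p ∈ Finset.univ.offDiag,
      ketbra (prodVec (EuclideanSpace.single p.1 1) (EuclideanSpace.single p.2 1)) := by
  have hsingle : ∀ p : κ × κ,
      ketbra (prodVec (EuclideanSpace.single p.1 1) (EuclideanSpace.single p.2 1))
        = Matrix.single p p 1 := fun p => by
    ext q r
    simp only [ketbra, prodVec, of_apply, PiLp.single_apply, single_apply, Prod.ext_iff]
    split_ifs <;> grind [star_one, star_zero]
  ext q r
  simp only [hsingle, offDiagProj, diagonal_apply, Matrix.sum_apply, single_apply]
  by_cases hqr : q = r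
  · subst hqr
    simp [Finset.sum_ite_eq']
  · simp only [hqr, if_false]
    refine (Finset.sum_eq_zero fun p _ => if_neg ?_).symm
    rintro ⟨rfl, rfl⟩
    exact hqr rfl

lemma smul_offDiagProj_mem_SEP {m : ℕ} (hm : 2 ≤ m) :
    (1 / ((m : ℝ) * (m - 1))) • offDiagProj (Fin m) ∈ SEP (Fin m) (Fin m) := by
  have hcard : ((Finset.univ : Finset (Fin m)).offDiag.card : ℝ) = m * (m - 1) := by
    rw [Finset.offDiag_card, Finset.card_univ, Fintype.card_fin,
      Nat.cast_sub (Nat.le_mul_self m), Nat.cast_mul]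
    ring
  have hne : (Finset.univ : Finset (Fin m)).offDiag.Nonempty :=
    ⟨(⟨0, by omega⟩, ⟨1, by omega⟩), by simp⟩
  rw [one_div, ← hcard, offDiagProj_eq_sum_ketbra]
  exact inv_card_smul_sum_mem convex_SEP hne fun p _ => ketbra_prodVec_mem_SEP (by simp) (by simp)

lemma ketbra_maxEntangled_apply {m : ℕ} (p q : Fin m × Fin m) :
    ketbra (maxEntangled m) p q = if p.1 = p.2 ∧ q.1 = q.2 then 1 / (m : ℂ) else 0 := by
  have hsq : ((1 / √m : ℝ) : ℂ) * ((1 / √m : ℝ) : ℂ) = 1 / (m : ℂ) := by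
    rw [← Complex.ofReal_mul, div_mul_div_comm, Real.mul_self_sqrt m.cast_nonneg]
    simp
  by_cases hp : p.1 = p.2 <;> by_cases hq : q.1 = q.2 <;>
    simp [ketbra, maxEntangled, hp, hq, -Complex.ofReal_div, -one_div, hsq]

/-- The unit vector with entries `χ (θ i) / √m`, for the standard character `χ` of `ℤ/3`. Three
phases are enough: all that is needed of the modulus is `2 ≠ 0`. -/
def phaseVec {m : ℕ} (θ : Fin m → ZMod 3) : EuclideanSpace ℂ (Fin m) :=
  WithLp.toLp 2 fun i => ((1 / √m : ℝ) : ℂ) * ZMod.stdAddChar (θ i)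

lemma norm_phaseVec {m : ℕ} (hm : 1 ≤ m) (θ : Fin m → ZMod 3) : ‖phaseVec θ‖ = 1 := by
  rw [← sq_eq_sq₀ (norm_nonneg _) zero_le_one, EuclideanSpace.norm_sq_eq]
  have hm0 : (m : ℝ) ≠ 0 := by positivity
  simp [phaseVec, AddChar.norm_apply, hm0]

lemma ketbra_prodVec_phaseVec_apply {m : ℕ} (θ : Fin m → ZMod 3) (p q : Fin m × Fin m) :
    ketbra (prodVec (phaseVec θ) (phaseVec (-θ))) p q
      = 1 / (m : ℂ) ^ 2 * ZMod.stdAddChar (θ p.1 - θ p.2 - θ q.1 + θ q.2) := by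
  have hscale : ((1 / √m : ℝ) : ℂ) ^ 4 = 1 / (m : ℂ) ^ 2 := by
    rw [← Complex.ofReal_pow, div_pow, one_pow, show √m ^ 4 = (√m ^ 2) ^ 2 by ring,
      Real.sq_sqrt m.cast_nonneg]
    simp
  have hphase : ZMod.stdAddChar (θ p.1 - θ p.2 - θ q.1 + θ q.2) = ZMod.stdAddChar (θ p.1)
      * ZMod.stdAddChar (-θ p.2) * (ZMod.stdAddChar (-θ q.1) * ZMod.stdAddChar (θ q.2)) := by
    simp only [← AddChar.map_add_eq_mul]
    congr 1
    ring
  rw [hphase, ← hscale]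
  simp only [ketbra, prodVec, phaseVec, of_apply, Pi.neg_apply, star_mul', Complex.star_def,
    ← AddChar.map_neg_eq_conj, neg_neg, Complex.conj_ofReal]
  ring

lemma average_ketbra_phaseVec_eq {m : ℕ} (hm : 1 ≤ m) :
    (Fintype.card (Fin m → ZMod 3) : ℝ)⁻¹ •
        ∑ θ : Fin m → ZMod 3, ketbra (prodVec (phaseVec θ) (phaseVec (-θ)))
      = (1 / (m : ℝ)) • ketbra (maxEntangled m) + (1 / (m : ℝ) ^ 2) • offDiagProj (Fin m) := by
  have h2 : (2 : ZMod 3) ≠ 0 := by decide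
  have hcard : (Fintype.card (Fin m → ZMod 3) : ℂ) ≠ 0 := by
    exact_mod_cast Fintype.card_ne_zero
  ext ⟨i, j⟩ ⟨k, l⟩
  have hlhs : ((Fintype.card (Fin m → ZMod 3) : ℝ)⁻¹ •
        ∑ θ : Fin m → ZMod 3, ketbra (prodVec (phaseVec θ) (phaseVec (-θ)))) (i, j) (k, l)
      = if (i = j ∧ k = l) ∨ (i = k ∧ j = l) then 1 / (m : ℂ) ^ 2 else 0 := by
    rw [Matrix.smul_apply, Matrix.sum_apply]
    simp only [ketbra_prodVec_phaseVec_apply]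
    rw [← Finset.mul_sum, sum_stdAddChar_sub_sub_add h2, Complex.real_smul]
    split_ifs
    · push_cast
      field_simp
    · simp
  rw [hlhs, Matrix.add_apply, Matrix.smul_apply, Matrix.smul_apply, ketbra_maxEntangled_apply]
  simp only [offDiagProj, diagonal_apply, Prod.mk.injEq, Complex.real_smul]
  by_cases hij : i = j <;> by_cases hkl : k = l <;> by_cases hik : i = k <;>
    by_cases hjl : j = l <;> simp_all [sq]

lemma ketbra_maxEntangled_add_offDiagProj_mem_SEP {m : ℕ} (hm : 1 ≤ m) :
    (1 / (m : ℝ)) • ketbra (maxEntangled m) + (1 / (m : ℝ) ^ 2) • offDiagProj (Fin m)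
      ∈ SEP (Fin m) (Fin m) := by
  rw [← average_ketbra_phaseVec_eq hm, ← Finset.card_univ]
  exact inv_card_smul_sum_mem convex_SEP Finset.univ_nonempty fun θ _ =>
    ketbra_prodVec_mem_SEP (norm_phaseVec hm θ) (norm_phaseVec hm (-θ))

lemma exists_mem_SEP_mix_maxEntangled_mem_SEP {m : ℕ} (hm : 1 ≤ m) :
    ∃ τ ∈ SEP (Fin m) (Fin m),
      (1 / (m : ℝ)) • ketbra (maxEntangled m) + (1 - 1 / (m : ℝ)) • τ ∈ SEP (Fin m) (Fin m) := by
  have hmix := ketbra_maxEntangled_add_offDiagProj_mem_SEP hm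
  rcases hm.eq_or_lt with rfl | hm2
  · have hproj : offDiagProj (Fin 1) = 0 := by
      ext p q
      simp [offDiagProj, diagonal_apply, Subsingleton.elim p.1 p.2]
    simp only [hproj, smul_zero, add_zero, Nat.cast_one, div_one, one_smul] at hmix
    exact ⟨_, hmix, by simpa using hmix⟩
  · refine ⟨_, smul_offDiagProj_mem_SEP hm2, ?_⟩
    have hm' : (2 : ℝ) ≤ m := by exact_mod_cast hm2
    have hm1 : (m : ℝ) - 1 ≠ 0 := by linarith
    have hweight : (1 - 1 / (m : ℝ)) * (1 / (m * (m - 1))) = 1 / (m : ℝ) ^ 2 := by field_simp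
    rwa [smul_smul, hweight]

end SeparabilityThreshold

section Fidelity

lemma maxEntangled_eq_schmidtMap (m : ℕ) : maxEntangled m =
    schmidtMap (fun i => EuclideanSpace.single i 1) (fun i => EuclideanSpace.single i 1)
      (toComplexVec fun _ => 1 / √m) := by
  ext ⟨i, j⟩
  simp [schmidtMap_apply, toComplexVec, maxEntangled, prodVec, eq_comm]

lemma norm_maxEntangled {m : ℕ} (hm : 1 ≤ m) : ‖maxEntangled m‖ = 1 := by
  have hbasis := EuclideanSpace.orthonormal_single (𝕜 := ℂ) (ι := Fin m)
  have hm0 : (m : ℝ) ≠ 0 := by positivity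
  rw [← sq_eq_sq₀ (norm_nonneg _) zero_le_one, maxEntangled_eq_schmidtMap,
    norm_schmidtMap hbasis hbasis, norm_toComplexVec_sq]
  simp [hm0]

lemma hsInner_ketbra_maxEntangled_le_of_mem_SEP {m : ℕ}
    {σ : Matrix (Fin m × Fin m) (Fin m × Fin m) ℂ} (hσ : σ ∈ SEP (Fin m) (Fin m)) :
    hsInner (ketbra (maxEntangled m)) σ ≤ 1 / m := by
  have hbasis := EuclideanSpace.orthonormal_single (𝕜 := ℂ) (ι := Fin m)
  have hcoeff : ∀ i, ‖toComplexVec (fun _ : Fin m => 1 / √(m : ℝ)) i‖ ≤ 1 / √m := fun i => by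
    simp [toComplexVec, abs_of_nonneg]
  have h := hsInner_ketbra_schmidtMap_le_of_mem_SEP hbasis hbasis (by positivity) hcoeff hσ
  rwa [← maxEntangled_eq_schmidtMap, div_pow, one_pow, Real.sq_sqrt m.cast_nonneg] at h

variable {a b ι : Type*} [Fintype a] [Fintype b]

lemma exists_mem_sepTests_of_mem_SEPP [DecidableEq a] [DecidableEq b] {m : ℕ} (hm : 1 ≤ m)
    {Λ : Matrix (a × b) (a × b) ℂ →ₗ[ℂ] Matrix (Fin m × Fin m) (Fin m × Fin m) ℂ}
    (hΛ : Λ ∈ SEPP a b (Fin m) (Fin m)) :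
    ∃ X ∈ sepTests a b m, ∀ ρ, hsInner ρ X = m * hsInner (Λ ρ) (ketbra (maxEntangled m)) := by
  have hm0 : (0 : ℝ) < m := by exact_mod_cast hm
  have hΨ1 : (1 - ketbra (maxEntangled m)).PosSemidef := by
    have h := posSemidef_smul_one_sub_ketbra (v := maxEntangled m) (m := 1)
      (by rw [norm_maxEntangled hm, one_pow])
    rwa [one_smul] at h
  obtain ⟨X, hX0, hX1, hX⟩ := hΛ.1.exists_pullback (posSemidef_ketbra _) hΨ1
  have hoverlap : ∀ ρ, hsInner ρ ((m : ℝ) • X)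
      = m * hsInner (Λ ρ) (ketbra (maxEntangled m)) := fun ρ => by
    rw [hsInner_smul_right, hsInner_comm ρ, hsInner_comm (Λ ρ), hsInner, hsInner,
      hX0.isHermitian.eq, (isHermitian_ketbra _).eq, hX]
  refine ⟨(m : ℝ) • X, ⟨hX0.smul hm0.le, ?_, fun σ hσ => ?_⟩, hoverlap⟩
  · rw [← smul_sub]
    exact hX1.smul hm0.le
  · rw [hsInner_comm, hoverlap, hsInner_comm, ← le_div_iff₀' hm0]
    exact hsInner_ketbra_maxEntangled_le_of_mem_SEP (hΛ.2 σ hσ)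

lemma exists_effect_of_mem_sepTests [DecidableEq a] [DecidableEq b] {m : ℝ} (hm : 0 < m)
    {X : Matrix (a × b) (a × b) ℂ} (hX : X ∈ sepTests a b m) :
    ∃ A : Matrix (a × b) (a × b) ℂ, A.PosSemidef ∧ (1 - A).PosSemidef ∧
      (∀ σ ∈ SEP a b, hsInner A σ ≤ 1 / m) ∧ X = m • A := by
  obtain ⟨hX0, hXm, hXsep⟩ := hX
  have hm' : 0 ≤ 1 / m := by positivity
  refine ⟨(1 / m) • X, hX0.smul hm', ?_, fun σ hσ => ?_, ?_⟩
  · have h := hXm.smul hm'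
    rwa [smul_sub, smul_smul, one_div_mul_cancel hm.ne', one_smul] at h
  · rw [hsInner_comm, hsInner_smul_right, hsInner_comm]
    exact mul_le_of_le_one_right hm' (hXsep σ hσ)
  · rw [smul_smul, mul_one_div_cancel hm.ne', one_smul]

lemma exists_mem_SEPP_of_mem_sepTests [DecidableEq a] [DecidableEq b] {m : ℕ} (hm : 1 ≤ m)
    {X : Matrix (a × b) (a × b) ℂ} (hX : X ∈ sepTests a b m) :
    ∃ Λ ∈ SEPP a b (Fin m) (Fin m), ∀ ρ : Matrix (a × b) (a × b) ℂ, ρ.PosSemidef →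
      hsInner ρ X ≤ m * hsInner (Λ ρ) (ketbra (maxEntangled m)) := by
  have hm0 : (0 : ℝ) < m := by exact_mod_cast hm
  obtain ⟨A, hA, hA1, hAsep, rfl⟩ := exists_effect_of_mem_sepTests hm0 hX
  obtain ⟨τ, hτ, hmix⟩ := exists_mem_SEP_mix_maxEntangled_mem_SEP hm
  set Ψ := ketbra (maxEntangled m)
  have hΨtr : Ψ.trace = 1 := by simp [Ψ, trace_ketbra, norm_maxEntangled hm]
  have hΨΨ : hsInner Ψ Ψ = 1 := by
    simp [Ψ, hsInner_ketbra_ketbra, inner_self_eq_norm_sq_to_K, norm_maxEntangled hm]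
  refine ⟨_, measurePrepare_add_mem_SEPP hA hA1 hAsep (posSemidef_ketbra _) hΨtr hτ
    (by positivity) hmix, fun ρ hρ => ?_⟩
  have hτρ : 0 ≤ hsInner (1 - A) ρ * hsInner Ψ τ :=
    mul_nonneg (hsInner_nonneg hA1 hρ)
      (hsInner_nonneg (posSemidef_ketbra _) (posSemidef_of_mem_SEP hτ))
  rw [hsInner_smul_right, LinearMap.add_apply, measurePrepare_apply_of_isHermitian hA.1 hρ.1,
    measurePrepare_apply_of_isHermitian hA1.1 hρ.1, hsInner_comm _ Ψ, hsInner_add_right,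
    hsInner_smul_right, hsInner_smul_right, hΨΨ, mul_one, hsInner_comm ρ]
  exact mul_le_mul_of_nonneg_left (le_add_of_nonneg_right hτρ) hm0.le

lemma isGreatest_fidelityValues_schmidtMap [Fintype ι] {e : ι → EuclideanSpace ℂ a}
    {f : ι → EuclideanSpace ℂ b} (he : Orthonormal ℂ e) (hf : Orthonormal ℂ f) {ξ : ι → ℝ}
    (hξ : ∀ i, 0 ≤ ξ i) {m : ℕ} (hm : 1 ≤ m) :
    IsGreatest
      (fidelityValues (SEPP a b (Fin m) (Fin m)) (ketbra (schmidtMap e f (toComplexVec ξ))))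
      (1 / (m : ℝ) * distNorm m (toComplexVec ξ) ^ 2) := by
  classical
  have hm0 : (0 : ℝ) < m := by exact_mod_cast hm
  have hupper : ∀ Λ ∈ SEPP a b (Fin m) (Fin m),
      hsInner (Λ (ketbra (schmidtMap e f (toComplexVec ξ)))) (ketbra (maxEntangled m))
        ≤ 1 / (m : ℝ) * distNorm m (toComplexVec ξ) ^ 2 := fun Λ hΛ => by
    obtain ⟨X, hX, hXΛ⟩ := exists_mem_sepTests_of_mem_SEPP hm hΛ
    rw [one_div_mul_eq_div, le_div_iff₀' hm0, ← hXΛ]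
    exact hsInner_ketbra_schmidtMap_le_distNorm_sq he hf hm0.le hX _
  refine ⟨?_, fun r ⟨Λ, hΛ, hr⟩ => hr ▸ hupper Λ hΛ⟩
  obtain ⟨X, hX, hXeq⟩ := exists_mem_sepTests_hsInner_eq he hf hξ hm0
  obtain ⟨Λ, hΛ, hXΛ⟩ := exists_mem_SEPP_of_mem_sepTests hm hX
  refine ⟨Λ, hΛ, (hupper Λ hΛ).antisymm' ?_⟩
  rw [one_div_mul_eq_div, div_le_iff₀' hm0, ← hXeq]
  exact hXΛ _ (posSemidef_ketbra _)

end Fidelity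

section SingularValueDecomposition

variable {𝕜 E F : Type*} [RCLike 𝕜] [NormedAddCommGroup E] [InnerProductSpace 𝕜 E]
  [FiniteDimensional 𝕜 E] [NormedAddCommGroup F] [InnerProductSpace 𝕜 F] [FiniteDimensional 𝕜 F]

lemma exists_orthonormalBasis_pairwise_inner_map_eq_zero (T : E →ₗ[𝕜] F) {n : ℕ}
    (hn : Module.finrank 𝕜 E = n) :
    ∃ e : OrthonormalBasis (Fin n) 𝕜 E, Pairwise fun i j => inner 𝕜 (T (e i)) (T (e j)) = 0 := by
  have hT := T.isSymmetric_adjoint_comp_self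
  refine ⟨hT.eigenvectorBasis hn, fun i j hij => ?_⟩
  dsimp only
  rw [← LinearMap.adjoint_inner_right, ← LinearMap.comp_apply, hT.apply_eigenvectorBasis,
    inner_smul_right, (hT.eigenvectorBasis hn).orthonormal.2 hij, mul_zero]

lemma exists_orthonormal_smul_eq {ι : Type*} [Fintype ι]
    (hι : Fintype.card ι ≤ Module.finrank 𝕜 F) {g : ι → F}
    (hg : Pairwise fun i j => inner 𝕜 (g i) (g j) = 0) :
    ∃ f : ι → F, Orthonormal 𝕜 f ∧ ∀ i, g i = (‖g i‖ : 𝕜) • f i := by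
  obtain ⟨φ⟩ : Nonempty (ι ↪ Fin (Module.finrank 𝕜 F)) :=
    Function.Embedding.nonempty_of_card_le (by simpa using hι)
  let v := Function.extend φ (fun i => (‖g i‖⁻¹ : 𝕜) • g i) 0
  have hv : ∀ i, v (φ i) = (‖g i‖⁻¹ : 𝕜) • g i := φ.injective.extend_apply _ _
  have hortho : Orthonormal 𝕜 ((φ '' {i | g i ≠ 0}).domRestrict v) := by
    constructor
    · rintro ⟨_, i, hi, rfl⟩
      simp [hv, norm_smul, norm_ne_zero_iff.2 hi]
    · rintro ⟨_, i, -, rfl⟩ ⟨_, j, -, rfl⟩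
      intro hφ
      have hne : i ≠ j := fun h => hφ (by simp only [h])
      simp [hv, inner_smul_left, inner_smul_right, hg hne]
  obtain ⟨B, hB⟩ := hortho.exists_orthonormalBasis_extension_of_card_eq (by simp)
  refine ⟨B ∘ φ, B.orthonormal.comp _ φ.injective, fun i => ?_⟩
  by_cases hi : g i = 0
  · simp [hi]
  · have hnorm : (‖g i‖ : 𝕜) ≠ 0 := by simpa using hi
    rw [Function.comp_apply, hB _ ⟨i, hi, rfl⟩, hv, smul_smul, mul_inv_cancel₀ hnorm, one_smul]

lemma exists_orthonormalBasis_map_eq_smul_orthonormal (T : E →ₗ[𝕜] F) {n : ℕ}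
    (hE : Module.finrank 𝕜 E = n) (hF : n ≤ Module.finrank 𝕜 F) :
    ∃ (ξ : Fin n → ℝ) (e : OrthonormalBasis (Fin n) 𝕜 E) (f : Fin n → F),
      (∀ i, 0 ≤ ξ i) ∧ Orthonormal 𝕜 f ∧ ∀ i, T (e i) = (ξ i : 𝕜) • f i := by
  obtain ⟨e, he⟩ := exists_orthonormalBasis_pairwise_inner_map_eq_zero T hE
  obtain ⟨f, hf, hfT⟩ := exists_orthonormal_smul_eq (by simpa using hF) he
  exact ⟨fun i => ‖T (e i)‖, e, f, fun _ => norm_nonneg _, hf, hfT⟩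

end SingularValueDecomposition

section SchmidtDecomposition

lemma orthonormal_toLp_star {ι a : Type*} [Fintype a] {e : ι → EuclideanSpace ℂ a}
    (he : Orthonormal ℂ e) : Orthonormal ℂ fun i => WithLp.toLp 2 (star (e i).ofLp) := by
  refine ⟨fun i => ?_, fun i j hij => ?_⟩
  · simpa [EuclideanSpace.norm_eq] using he.1 i
  · dsimp only
    rw [EuclideanSpace.inner_eq_star_dotProduct, star_star, dotProduct_comm,
      ← EuclideanSpace.inner_eq_star_dotProduct, he.2 hij.symm]

lemma exists_eq_schmidtMap {a b : Type*} [Fintype a] [Fintype b] {n : ℕ}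
    (ha : Fintype.card a = n) (hb : n ≤ Fintype.card b) (ψ : EuclideanSpace ℂ (a × b)) :
    ∃ (ξ : Fin n → ℝ) (e : Fin n → EuclideanSpace ℂ a) (f : Fin n → EuclideanSpace ℂ b),
      (∀ i, 0 ≤ ξ i) ∧ Orthonormal ℂ e ∧ Orthonormal ℂ f ∧
        ψ = schmidtMap e f (toComplexVec ξ) := by
  classical
  let T := Matrix.toEuclideanLin (Matrix.of fun y x => ψ (x, y))
  obtain ⟨ξ, e, f, hξ, hf, hT⟩ := exists_orthonormalBasis_map_eq_smul_orthonormal T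
    (finrank_euclideanSpace.trans ha) (by rwa [finrank_euclideanSpace])
  refine ⟨ξ, _, f, hξ, orthonormal_toLp_star e.orthonormal, hf, ?_⟩
  ext ⟨x, y⟩
  have hcolumn : T (EuclideanSpace.single x 1) y = ψ (x, y) := by
    simp [T, toLpLin_apply]
  rw [← hcolumn, ← e.sum_repr' (EuclideanSpace.single x 1)]
  simp only [map_sum, map_smul, hT, EuclideanSpace.inner_single_right, schmidtMap_apply,
    WithLp.ofLp_sum, WithLp.ofLp_smul, Finset.sum_apply, Pi.smul_apply, smul_eq_mul, one_mul]
  exact Finset.sum_congr rfl fun i _ => mul_left_comm _ _ _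

lemma exists_isSchmidtVector {dA dB : ℕ} (ψ : EuclideanSpace ℂ (Fin dA × Fin dB)) :
    ∃ ξ : Fin (min dA dB) → ℝ, IsSchmidtVector ψ ξ := by
  rcases le_total dA dB with h | h
  · obtain ⟨ξ, e, f, hξ, he, hf, hψ⟩ := exists_eq_schmidtMap (n := min dA dB)
      (by simp [h]) (by simp) ψ
    exact ⟨ξ, hξ, e, f, he, hf, hψ⟩
  · obtain ⟨ξ, f, e, hξ, hf, he, hψ⟩ := exists_eq_schmidtMap (n := min dA dB)
      (by simp [h]) (by simp) (WithLp.toLp 2 fun p => ψ p.swap)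
    refine ⟨ξ, hξ, e, f, he, hf, ?_⟩
    ext ⟨x, y⟩
    have hxy := congrArg (fun φ : EuclideanSpace ℂ _ => φ (y, x)) hψ
    simpa [schmidtMap_apply, prodVec, toComplexVec, mul_comm] using hxy

end SchmidtDecomposition

end Distill

end

theorem mainTheorem2_general (dA dB : ℕ) (ψ : EuclideanSpace ℂ (Fin dA × Fin dB)) :
    (∃ ξ : Fin (min dA dB) → ℝ, Distill.IsSchmidtVector ψ ξ) ∧
    ∀ ξ : Fin (min dA dB) → ℝ, Distill.IsSchmidtVector ψ ξ →
      (∀ m : ℝ, 0 < m →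
        IsGreatest (Distill.monotoneValues (Distill.SEP (Fin dA) (Fin dB)) (m - 1)
            (Distill.ketbra ψ))
          (Distill.monotone (Distill.SEP (Fin dA) (Fin dB)) (m - 1) (Distill.ketbra ψ)) ∧
        Distill.monotone (Distill.SEP (Fin dA) (Fin dB)) (m - 1) (Distill.ketbra ψ) =
          Distill.distNorm m (Distill.toComplexVec ξ) ^ 2 - ‖ψ‖ ^ 2) ∧
      (∀ m : ℕ, 1 ≤ m →
        IsGreatest (Distill.fidelityValues (Distill.SEPP (Fin dA) (Fin dB) (Fin m) (Fin m))
            (Distill.ketbra ψ))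
          (Distill.fidelitySEPP (Distill.ketbra ψ) m) ∧
        Distill.fidelitySEPP (Distill.ketbra ψ) m =
          (1 / (m : ℝ)) * Distill.distNorm (m : ℝ) (Distill.toComplexVec ξ) ^ 2) := by
  refine ⟨Distill.exists_isSchmidtVector ψ, ?_⟩
  rintro ξ ⟨hξ, e, f, he, hf, hψ⟩
  obtain rfl : ψ = Distill.schmidtMap e f (Distill.toComplexVec ξ) := hψ
  refine ⟨fun m hm => ?_, fun m hm => ?_⟩
  · have hmax := Distill.isGreatest_monotoneValues_schmidtMap he hf hξ hm
    rw [Distill.monotone, hmax.csSup_eq]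
    exact ⟨hmax, rfl⟩
  · have hmax := Distill.isGreatest_fidelityValues_schmidtMap he hf hξ hm
    rw [Distill.fidelitySEPP, hmax.csSup_eq]
    exact ⟨hmax, rfl⟩

theorem mainTheorem2 (dA dB : ℕ) (ψ : EuclideanSpace ℂ (Fin dA × Fin dB)) (hψ : ‖ψ‖ = 1) :
    (∃ ξ : Fin (min dA dB) → ℝ, Distill.IsSchmidtVector ψ ξ) ∧
    ∀ ξ : Fin (min dA dB) → ℝ, Distill.IsSchmidtVector ψ ξ →
      (∀ m : ℝ, 1 ≤ m →
        -- the monotone is a maximum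
        IsGreatest (Distill.monotoneValues (Distill.SEP (Fin dA) (Fin dB)) (m - 1)
            (Distill.ketbra ψ))
          (Distill.monotone (Distill.SEP (Fin dA) (Fin dB)) (m - 1) (Distill.ketbra ψ)) ∧
        Distill.monotone (Distill.SEP (Fin dA) (Fin dB)) (m - 1) (Distill.ketbra ψ) =
          Distill.distNorm m (Distill.toComplexVec ξ) ^ 2 - 1) ∧
      (∀ m : ℕ, 1 ≤ m →
        -- the fidelity is a supremum
        IsLUB (Distill.fidelityValues (Distill.SEPP (Fin dA) (Fin dB) (Fin m) (Fin m))
            (Distill.ketbra ψ))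
          (Distill.fidelitySEPP (Distill.ketbra ψ) m) ∧
        Distill.fidelitySEPP (Distill.ketbra ψ) m =
          (1 / (m : ℝ)) * Distill.distNorm (m : ℝ) (Distill.toComplexVec ξ) ^ 2) := by
  obtain ⟨hexists, h⟩ := mainTheorem2_general dA dB ψ
  rw [hψ, one_pow] at h
  exact ⟨hexists, fun ξ hξ => ⟨fun m hm => (h ξ hξ).1 m (by positivity),
    fun m hm => ((h ξ hξ).2 m hm).imp_left IsGreatest.isLUB⟩⟩
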